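/- A lattice path in $\mathbb Z^2$ with steps $(1,1)$, $(1,-1)$ is called a Dyck path; a path with steps $(1,1)$, $(1,-1)$, $(2,0)$ is called a Schröder path. (No positivity is required.) Let $D(p,q)$ be the Delannoy number, i.e. the number of lattice paths from $(0,0)$ to $(p,q)$ with steps $(1,0)$, $(0,1)$, $(1,1)$, and let $$B(k,n-k)=\frac{2k-n+1}{k+1}\binom nk$$ be the ballot number. Let $n\ge 0$ and consider the following Dyck paths from $(0,0)$ to $(2n,0)$: $$\eta_+:\ (0,0)\to(1,1)\to\dots\to(n,n)\to(n+1,n-1)\to\dots\to(2n,0),$$ $$\eta_-:\ (0,0)\to(1,-1)\to\dots\to(n,-n)\to(n+1,-n+1)\to\dots\to(2n,0),$$ $$\eta_-':\ (0,0)\to(1,1)\to(2,0)\to(3,1)\to\dots\to(2n,0).$$ Let $\Gamma$ be the closed region between $\eta_-$ and $\eta_+$, and $\Gamma'$ the closed region between $\eta_-'$ and $\eta_+$. For $k\in\mathbb Z$ let $F(k)$ (respectively $N(k)$) be the number of Schröder (respectively Dyck) paths from $(0,0)$ to $(2n,0)$ which lie inside $\Gamma$ and contain the point $(n,k)$, and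 let $N'(k)$ be the number of Dyck paths from $(0,0)$ to $(2n,0)$ which lie inside $\Gamma'$ and contain the point $(n,k)$; paths are regarded as polygonal curves in the plane. Then the following hold. 1. (Delannoy numbers) $F(k)^2\ge F(k+2)\,F(k-2)$ for all $k\in\mathbb Z$, and $F(2k-n)=D(k,n-k)^2$ for $0\le k\le n$. The sequence $\{D(k,n-k)\}_{0\le k\le n}$ is log-concave: $D(k,n-k)^2\ge D(k+1,n-k-1)\,D(k-1,n-k+1)$ for $1\le k\le n-1$. 2. (Binomial coefficients) $N(k)^2\ge N(k+2)\,N(k-2)$ for all $k\in\mathbb Z$, and $N(2k-n)=\binom nk^2$ for $0\le k\le n$. The sequence $\{\binom nk\}_{0\le k\le n}$ is log-concave: $\binom nk^2\ge\binom n{k+1}\binom n{k-1}$ for $1\le k\le n-1$. 3. (Ballot numbers) $N'(k)^2\ge N'(k+2)\,N'(k-2)$ for all $k\in\mathbb Z$, and $N'(2k-n)=B(k,n-k)^2$ for $n/2\le k\le n$. The sequence $\{B(k,n-k)\}_{n/2\le k\le n}$ is log-concave: $B(k,n-k)^2\ge B(k+1,n-k-1)\,B(k-1,n-k+1)$ whenever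 $n/2\le k-1$ and $k+1\le n$. -/

import Mathlib

/-! Lattice paths in the integer plane are encoded by their starting point and their list of steps. -/

/-- The lattice paths from `A` to `B` all of whose steps belong to `S`. -/
def latticePaths (S : Set (ℤ × ℤ)) (A B : ℤ × ℤ) : Set (List (ℤ × ℤ)) :=
  {s | (∀ v ∈ s, v ∈ S) ∧ A + s.sum = B}

/-- Steps of Dyck paths. -/
def dyckSteps : Set (ℤ × ℤ) := {(1, 1), (1, -1)}

/-- Steps of Schröder paths. -/
def schroederSteps : Set (ℤ × ℤ) := {(1, 1), (1, -1), (2, 0)}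

/-- The Delannoy number `D(p, q)`: the number of lattice paths from `(0, 0)` to `(p, q)`
with steps `(1, 0)`, `(0, 1)`, `(1, 1)`. -/
noncomputable def delannoy (p q : ℕ) : ℕ :=
  (latticePaths {(1, 0), (0, 1), (1, 1)} (0, 0) ((p : ℤ), (q : ℤ))).ncard

/-- The ballot number `B(p, q) = (p - q + 1) / (p + 1) * binom(p + q, p)`, as a rational number. -/
def ballotNumber (p q : ℕ) : ℚ :=
  ((p : ℚ) - (q : ℚ) + 1) / ((p : ℚ) + 1) * ((p + q).choose p : ℚ)

/-- A lattice point as a point of the real plane. -/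
def toPlane (P : ℤ × ℤ) : ℝ × ℝ := ((P.1 : ℝ), (P.2 : ℝ))

/-- The polygonal curve in the real plane traced by the path from `A` with the given steps. -/
def pathTrace : ℤ × ℤ → List (ℤ × ℤ) → Set (ℝ × ℝ)
  | A, [] => {toPlane A}
  | A, v :: s => segment ℝ (toPlane A) (toPlane (A + v)) ∪ pathTrace (A + v) s

/-- The closed region between two curves: the points that lie weakly above a point of the lower
curve and weakly below a point of the upper curve on the same vertical line. -/
def closedRegionBetween (lower upper : Set (ℝ × ℝ)) : Set (ℝ × ℝ) :=
  {P | ∃ a b : ℝ, (P.1, a) ∈ lower ∧ (P.1, b) ∈ upper ∧ a ≤ P.2 ∧ P.2 ≤ b}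

/-- The number of lattice paths from `A` to `B` with steps in `S` which lie inside the region
between the paths `lower` and `upper` (both starting at `A`) and contain the point `(l, k)`. -/
noncomputable def countPathsThrough (S : Set (ℤ × ℤ)) (A B : ℤ × ℤ)
    (lower upper : List (ℤ × ℤ)) (l k : ℤ) : ℕ :=
  {s ∈ latticePaths S A B |
    pathTrace A s ⊆ closedRegionBetween (pathTrace A lower) (pathTrace A upper) ∧
    toPlane (l, k) ∈ pathTrace A s}.ncard

/-- The maximal path `(0,0) → (1,1) → … → (n,n) → (n+1,n-1) → … → (2n,0)`. -/
def maxPath (n : ℕ) : List (ℤ × ℤ) := List.replicate n (1, 1) ++ List.replicate n (1, -1)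

/-- The minimal path `(0,0) → (1,-1) → … → (n,-n) → (n+1,-n+1) → … → (2n,0)`. -/
def minPath (n : ℕ) : List (ℤ × ℤ) := List.replicate n (1, -1) ++ List.replicate n (1, 1)

/-- The zigzag path `(0,0) → (1,1) → (2,0) → (3,1) → … → (2n,0)`. -/
def zigzagPath (n : ℕ) : List (ℤ × ℤ) := (List.replicate n [(1, 1), (1, -1)]).flatten

/-- Schröder paths from `(0,0)` to `(2n,0)` between the minimal and the maximal path,
through `(n,k)`. -/
noncomputable def schroederCount (n : ℕ) (k : ℤ) : ℕ :=
  countPathsThrough schroederSteps (0, 0) (2 * (n : ℤ), 0) (minPath n) (maxPath n) n k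

/-- Dyck paths from `(0,0)` to `(2n,0)` between the minimal and the maximal path,
through `(n,k)`. -/
noncomputable def dyckCount (n : ℕ) (k : ℤ) : ℕ :=
  countPathsThrough dyckSteps (0, 0) (2 * (n : ℤ), 0) (minPath n) (maxPath n) n k

/-- Dyck paths from `(0,0)` to `(2n,0)` between the zigzag and the maximal path,
through `(n,k)`. -/
noncomputable def zigzagDyckCount (n : ℕ) (k : ℤ) : ℕ :=
  countPathsThrough dyckSteps (0, 0) (2 * (n : ℤ), 0) (zigzagPath n) (maxPath n) n k

/-!
A path through `(n, k)` splits at the line `x = n` into a path from `(0, 0)` to `(n, k)` and a path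
from `(n, k)` to `(2n, 0)`, and a symmetry of the plane exchanges the two families of halves.
Hence each of the three counting functions is the square of a number of half paths:
`schroederCount_of_even`, `dyckCount_eq_sq` and `zigzagDyckCount_eq_sq`. A Schröder path may also
contain `(n, k)` as the midpoint of a horizontal step; this is the only possibility when `n + k`
is odd, and then the halves end at abscissa `n - 1` (`schroederCount_of_not_even`). The two
regions impose little on the paths: every Schröder path lies between the minimal and the maximal
path since its slopes are at most `1` in absolute value (`pathTrace_subset_region`), and by parity a
Dyck path lies above the zigzag path if and only if it never becomes negative
(`pathTrace_subset_zigzag_region_iff`).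

In the coordinates `p + q = l`, `p - q = k` the half paths to `(l, k)` are counted by the Delannoy
number `D(p, q)`, by the binomial coefficient `binom(p + q, p)` and by the ballot number `B(p, q)`,
since both sides satisfy the recursion given by the first step (`ncard_schroederPaths`,
`ncard_dyckPaths`, `ncard_nonnegDyckPaths`).

It remains to see that the three arrays are log-concave along antidiagonals. The binomial
coefficients and the ballot numbers are treated by their closed formulas. For the Delannoy numbers
one proves by induction, together with log-concavity, that consecutive antidiagonals interlace
(`delannoyRec_interlacing`); the product of the two interlacing inequalities is the log-concavity
of the next antidiagonal.
-/

/-! ### Counting lists by their first entry -/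

/-- The decomposition by the first entry. Cardinalities are taken in `ℕ∞`, so that the recursions
derived from it do not presuppose finiteness. -/
lemma encard_eq_sum_encard_cons_mem {α : Type*} (T : Finset α) (X : Set (List α)) (hnil : [] ∉ X)
    (hX : ∀ v s, v :: s ∈ X → v ∈ T) :
    X.encard = ∑ v ∈ T, {s | v :: s ∈ X}.encard := by
  classical
  induction T using Finset.induction_on generalizing X with
  | empty =>
    have : X = ∅ := by
      ext s
      cases s with
      | nil => simpa using hnil
      | cons v s => simpa using hX v s
    simp [this]
  | insert a T ha ih =>
    let X' : Set (List α) := {l ∈ X | ∀ s, l ≠ a :: s}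
    have hsplit : X = (List.cons a '' {s | a :: s ∈ X}) ∪ X' := by
      ext l
      constructor
      · intro hl
        by_cases h : ∃ s, l = a :: s
        · obtain ⟨s, rfl⟩ := h
          exact Or.inl ⟨s, hl, rfl⟩
        · exact Or.inr ⟨hl, fun s hs => h ⟨s, hs⟩⟩
      · rintro (⟨s, hs, rfl⟩ | hl)
        · exact hs
        · exact hl.1
    have hdisj : Disjoint (List.cons a '' {s | a :: s ∈ X}) X' := by
      rw [Set.disjoint_left]
      rintro _ ⟨s, -, rfl⟩ h
      exact h.2 s rfl
    have hX' := ih X' (fun h => hnil h.1) (by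
      intro v s h
      rcases Finset.mem_insert.1 (hX v s h.1) with rfl | h'
      · exact absurd rfl (h.2 s)
      · exact h')
    have hcongr : ∀ v ∈ T, {s | v :: s ∈ X'}.encard = {s | v :: s ∈ X}.encard := by
      intro v hv
      congr 1
      ext s
      have hva : v ≠ a := fun h => ha (h ▸ hv)
      simp [X', hva]
    rw [Finset.sum_insert ha, ← Finset.sum_congr rfl hcongr, ← hX']
    conv_lhs => rw [hsplit]
    rw [Set.encard_union_eq hdisj, (List.cons_injective).encard_image]

/-! ### Displacements of lattice paths -/

lemma mem_latticePaths_zero {S : Set (ℤ × ℤ)} {B : ℤ × ℤ} {s : List (ℤ × ℤ)} :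
    s ∈ latticePaths S (0, 0) B ↔ (∀ v ∈ s, v ∈ S) ∧ s.sum = B := by
  simp [latticePaths, Prod.mk_zero_zero]

lemma cons_mem_latticePaths_zero {S : Set (ℤ × ℤ)} {B v : ℤ × ℤ} (hv : v ∈ S)
    {s : List (ℤ × ℤ)} :
    v :: s ∈ latticePaths S (0, 0) B ↔ s ∈ latticePaths S (0, 0) (B - v) := by
  simp only [mem_latticePaths_zero, List.mem_cons, forall_eq_or_imp,
    List.sum_cons, eq_sub_iff_add_eq', hv, true_and]

lemma encard_latticePaths_zero_eq_sum (T : Finset (ℤ × ℤ)) {B : ℤ × ℤ} (hB : B ≠ (0, 0)) :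
    (latticePaths T (0, 0) B).encard = ∑ v ∈ T, (latticePaths T (0, 0) (B - v)).encard := by
  rw [encard_eq_sum_encard_cons_mem T]
  · refine Finset.sum_congr rfl fun v hv => ?_
    simp only [cons_mem_latticePaths_zero (Finset.mem_coe.2 hv), Set.ofPred_mem_eq]
  · intro h
    exact hB (mem_latticePaths_zero.1 h).2.symm
  · intro v s h
    exact (mem_latticePaths_zero.1 h).1 v (by simp)

lemma fst_sum_nonneg {s : List (ℤ × ℤ)} (h : ∀ v ∈ s, 0 ≤ v.1) : 0 ≤ s.sum.1 := by
  induction s with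
  | nil => simp
  | cons v s ih =>
    simp only [List.mem_cons, forall_eq_or_imp] at h
    have := ih h.2
    simp only [List.sum_cons, Prod.fst_add]
    omega

lemma snd_sum_nonneg {s : List (ℤ × ℤ)} (h : ∀ v ∈ s, 0 ≤ v.2) : 0 ≤ s.sum.2 := by
  induction s with
  | nil => simp
  | cons v s ih =>
    simp only [List.mem_cons, forall_eq_or_imp] at h
    have := ih h.2
    simp only [List.sum_cons, Prod.snd_add]
    omega

lemma fst_add_snd_sum_nonneg {s : List (ℤ × ℤ)} (h : ∀ v ∈ s, 0 ≤ v.1 + v.2) :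
    0 ≤ s.sum.1 + s.sum.2 := by
  induction s with
  | nil => simp
  | cons v s ih =>
    simp only [List.mem_cons, forall_eq_or_imp] at h
    have := ih h.2
    simp only [List.sum_cons, Prod.fst_add, Prod.snd_add]
    omega

lemma latticePaths_zero_eq_empty_of_neg {S : Set (ℤ × ℤ)} (hS : ∀ v ∈ S, 0 ≤ v.1 ∧ 0 ≤ v.2)
    {p q : ℤ} (h : p < 0 ∨ q < 0) : latticePaths S (0, 0) (p, q) = ∅ := by
  ext s
  simp only [mem_latticePaths_zero, Set.mem_empty_iff_false, iff_false, not_and]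
  intro hs hsum
  have h1 := fst_sum_nonneg fun v hv => (hS v (hs v hv)).1
  have h2 := snd_sum_nonneg fun v hv => (hS v (hs v hv)).2
  rw [hsum] at h1 h2
  simp only at h1 h2
  omega

lemma latticePaths_zero_self {S : Set (ℤ × ℤ)} (hS : ∀ v ∈ S, 0 < v.1 + v.2) :
    latticePaths S (0, 0) (0, 0) = {[]} := by
  ext s
  simp only [mem_latticePaths_zero, Set.mem_singleton_iff]
  constructor
  · rintro ⟨h, hsum⟩
    cases s with
    | nil => rfl
    | cons v s =>
      simp only [List.mem_cons, forall_eq_or_imp] at h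
      have h1 := fst_add_snd_sum_nonneg fun v hv => (hS v (h.2 v hv)).le
      have h2 := hS v h.1
      have h3 := congrArg Prod.fst hsum
      have h4 := congrArg Prod.snd hsum
      simp only [List.sum_cons, Prod.fst_add, Prod.snd_add] at h3 h4
      omega
  · rintro rfl
    exact ⟨by simp, rfl⟩

/-- An injective additive change of coordinates preserves the number of paths. -/
lemma ncard_latticePaths_image (φ : ℤ × ℤ →+ ℤ × ℤ) (hφ : Function.Injective φ)
    (S : Set (ℤ × ℤ)) (B : ℤ × ℤ) :
    (latticePaths (φ '' S) (0, 0) (φ B)).ncard = (latticePaths S (0, 0) B).ncard := by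
  have h : latticePaths (φ '' S) (0, 0) (φ B) = List.map φ '' latticePaths S (0, 0) B := by
    ext s
    simp only [mem_latticePaths_zero, Set.mem_image]
    constructor
    · rintro ⟨h1, h2⟩
      have hlift : ∀ s : List (ℤ × ℤ), (∀ v ∈ s, v ∈ φ '' S) →
          ∃ t, (∀ v ∈ t, v ∈ S) ∧ List.map φ t = s := by
        intro s
        induction s with
        | nil => exact fun _ => ⟨[], by simp⟩
        | cons v s ih =>
          intro h
          simp only [List.mem_cons, forall_eq_or_imp] at h
          obtain ⟨t, ht, rfl⟩ := ih h.2
          obtain ⟨w, hw, rfl⟩ := h.1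
          exact ⟨w :: t, by simpa using ⟨hw, fun a b => ht (a, b)⟩, rfl⟩
      obtain ⟨t, ht, rfl⟩ := hlift s h1
      refine ⟨t, ⟨ht, hφ ?_⟩, rfl⟩
      rw [← h2, map_list_sum]
    · rintro ⟨t, ⟨ht, rfl⟩, rfl⟩
      refine ⟨fun v hv => ?_, (map_list_sum φ t).symm⟩
      obtain ⟨w, hw, rfl⟩ := List.mem_map.1 hv
      exact ⟨w, ht w hw, rfl⟩
  rw [h, Set.ncard_image_of_injective _ (List.map_injective_iff.2 hφ)]

/-! ### Delannoy numbers and binomial coefficients as path counts -/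

/-- The Delannoy numbers, defined by their three-term recursion. -/
def delannoyRec : ℕ → ℕ → ℕ
  | 0, _ => 1
  | _ + 1, 0 => 1
  | p + 1, q + 1 => delannoyRec p (q + 1) + delannoyRec (p + 1) q + delannoyRec p q

lemma delannoyRec_zero_right (p : ℕ) : delannoyRec p 0 = 1 := by
  cases p <;> simp [delannoyRec]

lemma encard_delannoyPaths (p q : ℕ) :
    (latticePaths {(1, 0), (0, 1), (1, 1)} (0, 0) ((p : ℤ), (q : ℤ))).encard =
      delannoyRec p q := by
  have hnonneg : ∀ v ∈ ({(1, 0), (0, 1), (1, 1)} : Set (ℤ × ℤ)), 0 ≤ v.1 ∧ 0 ≤ v.2 := by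
    simp
  have hneg := fun p q h => latticePaths_zero_eq_empty_of_neg hnonneg (p := p) (q := q) h
  have hstep : ∀ p q : ℤ, (p, q) ≠ (0, 0) →
      (latticePaths {(1, 0), (0, 1), (1, 1)} (0, 0) (p, q)).encard =
      (latticePaths {(1, 0), (0, 1), (1, 1)} (0, 0) (p - 1, q)).encard +
      ((latticePaths {(1, 0), (0, 1), (1, 1)} (0, 0) (p, q - 1)).encard +
      (latticePaths {(1, 0), (0, 1), (1, 1)} (0, 0) (p - 1, q - 1)).encard) := by
    intro p q h
    have := encard_latticePaths_zero_eq_sum {(1, 0), (0, 1), (1, 1)} h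
    simpa using this
  induction p generalizing q with
  | zero =>
    induction q with
    | zero =>
      have := latticePaths_zero_self (S := {(1, 0), (0, 1), (1, 1)}) (by simp)
      simp only [Nat.cast_zero]
      rw [this]
      simp [delannoyRec]
    | succ q ih =>
      rw [hstep _ _ (by simp; omega), hneg (_ - 1) _ (by simp), hneg (_ - 1) _ (by simp)]
      have : ((q + 1 : ℕ) : ℤ) - 1 = q := by simp
      rw [this, ih]
      simp [delannoyRec]
  | succ p ihp =>
    have hp : ((p + 1 : ℕ) : ℤ) - 1 = p := by simp
    induction q with
    | zero =>
      rw [hstep _ _ (by simp; omega), hneg _ (_ - 1) (by simp), hneg _ (_ - 1) (by simp), hp, ihp,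
        delannoyRec_zero_right]
      simp [delannoyRec]
    | succ q ihq =>
      have hq : ((q + 1 : ℕ) : ℤ) - 1 = q := by simp
      rw [hstep _ _ (by simp; omega), hp, hq, ihp, ihp, ihq]
      simp [delannoyRec, add_assoc]

lemma delannoy_eq_delannoyRec (p q : ℕ) : delannoy p q = delannoyRec p q := by
  simp [delannoy, Set.ncard, encard_delannoyPaths]

lemma encard_binomialPaths (p q : ℕ) :
    (latticePaths {(1, 0), (0, 1)} (0, 0) ((p : ℤ), (q : ℤ))).encard = (p + q).choose p := by
  have hnonneg : ∀ v ∈ ({(1, 0), (0, 1)} : Set (ℤ × ℤ)), 0 ≤ v.1 ∧ 0 ≤ v.2 := by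
    simp
  have hneg := fun p q h => latticePaths_zero_eq_empty_of_neg hnonneg (p := p) (q := q) h
  have hstep : ∀ p q : ℤ, (p, q) ≠ (0, 0) →
      (latticePaths {(1, 0), (0, 1)} (0, 0) (p, q)).encard =
      (latticePaths {(1, 0), (0, 1)} (0, 0) (p - 1, q)).encard +
      (latticePaths {(1, 0), (0, 1)} (0, 0) (p, q - 1)).encard := by
    intro p q h
    have := encard_latticePaths_zero_eq_sum {(1, 0), (0, 1)} h
    simpa using this
  induction p generalizing q with
  | zero =>
    induction q with
    | zero =>
      have := latticePaths_zero_self (S := {(1, 0), (0, 1)}) (by simp)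
      simp only [Nat.cast_zero]
      rw [this]
      simp
    | succ q ih =>
      rw [hstep _ _ (by simp; omega), hneg (_ - 1) _ (by simp)]
      have : ((q + 1 : ℕ) : ℤ) - 1 = q := by simp
      rw [this, ih]
      simp
  | succ p ihp =>
    have hp : ((p + 1 : ℕ) : ℤ) - 1 = p := by simp
    induction q with
    | zero =>
      rw [hstep _ _ (by simp; omega), hneg _ (_ - 1) (by simp), hp, ihp]
      simp
    | succ q ihq =>
      have hq : ((q + 1 : ℕ) : ℤ) - 1 = q := by simp
      rw [hstep _ _ (by simp; omega), hp, hq, ihp, ihq, ← Nat.cast_add]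
      congr 1
      rw [show p + 1 + (q + 1) = p + (q + 1) + 1 by ring, Nat.choose_succ_succ,
        show p + 1 + q = p + (q + 1) by ring]

/-! ### Log-concavity of the three sequences -/

lemma delannoyRec_comm (p q : ℕ) : delannoyRec p q = delannoyRec q p := by
  induction p generalizing q with
  | zero => rw [delannoyRec_zero_right, delannoyRec]
  | succ p ihp =>
    induction q with
    | zero => rw [delannoyRec_zero_right, delannoyRec]
    | succ q ihq =>
      simp only [delannoyRec]
      rw [ihp (q + 1), ihp q, ihq]
      ring

lemma delannoyRec_pos (p q : ℕ) : 0 < delannoyRec p q := by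
  induction p generalizing q with
  | zero => simp [delannoyRec]
  | succ p ihp =>
    cases q with
    | zero => simp [delannoyRec]
    | succ q => simp only [delannoyRec]; have := ihp q; omega

/-- Interlacing of two consecutive antidiagonals of the Delannoy array, together with the
log-concavity of the antidiagonals: the three inequalities reproduce themselves under the
recursion, and the third one follows from the first two. -/
lemma delannoyRec_interlacing (m : ℕ) : ∀ p q, p + q = m →
    delannoyRec p (q + 2) * delannoyRec (p + 1) q ≤
        delannoyRec (p + 1) (q + 1) * delannoyRec p (q + 1) ∧
      delannoyRec (p + 2) q * delannoyRec p (q + 1) ≤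
        delannoyRec (p + 1) (q + 1) * delannoyRec (p + 1) q ∧
      delannoyRec (p + 2) q * delannoyRec p (q + 2) ≤ delannoyRec (p + 1) (q + 1) ^ 2 := by
  induction m with
  | zero =>
    rintro p q h
    obtain ⟨rfl, rfl⟩ : p = 0 ∧ q = 0 := by omega
    norm_num [delannoyRec]
  | succ m ih =>
    -- the first inequality on the next antidiagonal; the second one is its mirror image
    have key : ∀ p q, p + q = m + 1 →
        delannoyRec p (q + 2) * delannoyRec (p + 1) q ≤
          delannoyRec (p + 1) (q + 1) * delannoyRec p (q + 1) := by
      intro p q h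
      have e1 : delannoyRec (p + 1) (q + 1) =
        delannoyRec p (q + 1) + delannoyRec (p + 1) q + delannoyRec p q := by rw [delannoyRec]
      rcases p with _ | p
      · have e2 : ∀ k, delannoyRec 0 k = 1 := fun k => by rw [delannoyRec]
        rw [e1]
        simp only [e2]
        omega
      · have e2 : delannoyRec (p + 1) (q + 2) =
            delannoyRec p (q + 2) + delannoyRec (p + 1) (q + 1) + delannoyRec p (q + 1) := by
          rw [delannoyRec]
        -- after expansion one term cancels, and the others are compared by the second inequality
        -- and by log-concavity on the previous antidiagonal
        obtain ⟨-, h2, h3⟩ := ih p q (by omega)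
        rw [e1, e2]
        simp only [show p + 1 + 1 = p + 2 from rfl]
        nlinarith
    intro p q h
    have h1 := key p q h
    have h2 : delannoyRec (p + 2) q * delannoyRec p (q + 1) ≤
        delannoyRec (p + 1) (q + 1) * delannoyRec (p + 1) q := by
      have := key q p (by omega)
      rwa [delannoyRec_comm q, delannoyRec_comm (q + 1), delannoyRec_comm (q + 1),
        delannoyRec_comm q] at this
    refine ⟨h1, h2, ?_⟩
    -- multiply the two interlacing inequalities and cancel the common factor
    have hpos := Nat.mul_pos (delannoyRec_pos p (q + 1)) (delannoyRec_pos (p + 1) q)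
    refine Nat.le_of_mul_le_mul_right ?_ hpos
    calc _ = (delannoyRec (p + 2) q * delannoyRec p (q + 1)) *
          (delannoyRec p (q + 2) * delannoyRec (p + 1) q) := by ring
      _ ≤ _ := Nat.mul_le_mul h2 h1
      _ = _ := by ring

lemma delannoy_logConcave (p q : ℕ) :
    delannoy (p + 2) q * delannoy p (q + 2) ≤ delannoy (p + 1) (q + 1) ^ 2 := by
  simp only [delannoy_eq_delannoyRec]
  exact (delannoyRec_interlacing _ p q rfl).2.2

lemma choose_logConcave (n k : ℕ) :
    n.choose (k + 2) * n.choose k ≤ n.choose (k + 1) ^ 2 := by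
  have h1 := Nat.choose_succ_right_eq n k
  have h2 := Nat.choose_succ_right_eq n (k + 1)
  have hle : n - (k + 1) ≤ n - k := by omega
  have h3 : n.choose (k + 2) * n.choose k * ((k + 2) * (n - k)) ≤
      n.choose (k + 1) ^ 2 * ((k + 2) * (n - k)) := by
    calc _ = (n.choose (k + 1 + 1) * (k + 1 + 1)) * (n.choose k * (n - k)) := by ring
      _ = n.choose (k + 1) ^ 2 * ((n - (k + 1)) * (k + 1)) := by rw [← h1, h2]; ring
      _ ≤ n.choose (k + 1) ^ 2 * ((n - k) * (k + 2)) := by gcongr; omega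
      _ = _ := by ring
  rcases Nat.eq_zero_or_pos (n - k) with h | h
  · rw [Nat.choose_eq_zero_of_lt (by omega : n < k + 2)]
    simp
  · exact Nat.le_of_mul_le_mul_right h3 (by positivity)

/-- The log-concavity of the ballot numbers follows from that of the binomial coefficients:
the factors `p - q + 1` form an arithmetic progression, and the factors `1 / (p + 1)`, which are
log-convex, are compensated for by `binom(n, p)`. -/
lemma ballotNumber_logConcave {p q : ℕ} (h : q + 2 ≤ p) :
    ballotNumber (p + 2) q * ballotNumber p (q + 2) ≤ ballotNumber (p + 1) (q + 1) ^ 2 := by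
  have h1 := Nat.choose_succ_right_eq (p + q + 2) p
  have h2 := Nat.choose_succ_right_eq (p + q + 2) (p + 1)
  rw [show p + q + 2 - p = q + 2 by omega] at h1
  rw [show p + q + 2 - (p + 1) = q + 1 by omega] at h2
  unfold ballotNumber
  rw [show p + 2 + q = p + q + 2 by ring, show p + (q + 2) = p + q + 2 by ring,
    show p + 1 + (q + 1) = p + q + 2 by ring]
  set x := (p + q + 2).choose p
  set y := (p + q + 2).choose (p + 1)
  set z := (p + q + 2).choose (p + 1 + 1)
  have h1' : (y : ℚ) * (p + 1) = x * (q + 2) := by exact_mod_cast h1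
  have h2' : (z : ℚ) * (p + 2) = y * (q + 1) := by
    have : (z : ℚ) * (p + 1 + 1) = y * (q + 1) := by exact_mod_cast h2
    linarith
  have hx : (x : ℚ) = y * (p + 1) / (q + 2) := by
    rw [eq_div_iff (by positivity)]; linarith
  have hz' : (z : ℚ) = y * (q + 1) / (p + 2) := by
    rw [eq_div_iff (by positivity)]; linarith
  have hqp : (q : ℚ) + 2 ≤ p := by exact_mod_cast h
  push_cast
  rw [hx, hz']
  have e1 : ((p : ℚ) + 2 - q + 1) / (p + 2 + 1) * (y * (q + 1) / (p + 2)) *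
      ((p - (q + 2) + 1) / (p + 1) * (y * (p + 1) / (q + 2))) =
      (y : ℚ) ^ 2 * ((p - q + 3) * (p - q - 1)) * ((q + 1) / ((p + 3) * (p + 2) * (q + 2))) := by
    field_simp
    ring
  have e2 : (((p : ℚ) + 1 - (q + 1) + 1) / (p + 1 + 1) * y) ^ 2 =
      (y : ℚ) ^ 2 * (p - q + 1) ^ 2 * (1 / ((p + 2) * (p + 2))) := by
    field_simp
    ring
  rw [e1, e2]
  have h3 : ((p : ℚ) - q + 3) * (p - q - 1) ≤ (p - q + 1) ^ 2 := by nlinarith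
  have h4 : ((q : ℚ) + 1) / ((p + 3) * (p + 2) * (q + 2)) ≤ 1 / ((p + 2) * (p + 2)) := by
    rw [div_le_div_iff₀ (by positivity) (by positivity)]
    have : (0 : ℚ) ≤ p := by positivity
    have : (0 : ℚ) ≤ q := by positivity
    have h5 : ((q : ℚ) + 1) * (p + 2) ≤ (p + 3) * (q + 2) := by nlinarith
    calc ((q : ℚ) + 1) * ((p + 2) * (p + 2)) = ((q + 1) * (p + 2)) * (p + 2) := by ring
      _ ≤ ((p + 3) * (q + 2)) * (p + 2) := by gcongr
      _ = _ := by ring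
  gcongr

/-! ### Paths that stay above the horizontal axis -/

/-- A path starting at height `h` whose vertices all have nonnegative height. -/
def StaysNonneg : ℤ → List (ℤ × ℤ) → Prop
  | h, [] => 0 ≤ h
  | h, v :: s => 0 ≤ h ∧ StaysNonneg (h + v.2) s

lemma StaysNonneg.start_nonneg {h : ℤ} {s : List (ℤ × ℤ)} (hs : StaysNonneg h s) : 0 ≤ h := by
  cases s with
  | nil => exact hs
  | cons v s => exact hs.1

lemma staysNonneg_append {h : ℤ} {s t : List (ℤ × ℤ)} :
    StaysNonneg h (s ++ t) ↔ StaysNonneg h s ∧ StaysNonneg (h + s.sum.2) t := by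
  induction s generalizing h with
  | nil =>
    simp only [List.nil_append, List.sum_nil, Prod.snd_zero, add_zero, StaysNonneg]
    exact ⟨fun H => ⟨H.start_nonneg, H⟩, fun H => H.2⟩
  | cons v s ih =>
    simp only [List.cons_append, StaysNonneg, ih, List.sum_cons, Prod.snd_add, and_assoc, add_assoc]

/-- The reflection of the plane in the horizontal axis. -/
def reflect : ℤ × ℤ →+ ℤ × ℤ where
  toFun v := (v.1, -v.2)
  map_zero' := rfl
  map_add' v w := by ext <;> simp [add_comm]

lemma reflect_apply (v : ℤ × ℤ) : reflect v = (v.1, -v.2) := rfl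

lemma reflect_reflect (v : ℤ × ℤ) : reflect (reflect v) = v := by simp [reflect_apply]

lemma reflect_injective : Function.Injective reflect :=
  Function.LeftInverse.injective reflect_reflect

/-- The mirror image of a path in a vertical line: the order of the steps is reversed, and
the vertical component of each step changes its sign. -/
def mirror (s : List (ℤ × ℤ)) : List (ℤ × ℤ) := (s.map reflect).reverse

lemma mirror_cons (v : ℤ × ℤ) (s : List (ℤ × ℤ)) : mirror (v :: s) = mirror s ++ [reflect v] := by
  simp [mirror]

lemma mirror_mirror (s : List (ℤ × ℤ)) : mirror (mirror s) = s := by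
  have : reflect ∘ reflect = id := funext reflect_reflect
  simp [mirror, this]

lemma sum_mirror (s : List (ℤ × ℤ)) : (mirror s).sum = reflect s.sum := by
  rw [mirror, List.sum_reverse, map_list_sum]

lemma mem_mirror {v : ℤ × ℤ} {s : List (ℤ × ℤ)} : v ∈ mirror s ↔ reflect v ∈ s := by
  simp only [mirror, List.mem_reverse, List.mem_map]
  constructor
  · rintro ⟨w, hw, rfl⟩
    rwa [reflect_reflect]
  · exact fun h => ⟨_, h, reflect_reflect v⟩

lemma StaysNonneg.mirror {h : ℤ} {s : List (ℤ × ℤ)} (hs : StaysNonneg h s) :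
    StaysNonneg (h + s.sum.2) (mirror s) := by
  induction s generalizing h with
  | nil => simpa [_root_.mirror] using hs
  | cons v s ih =>
    have := ih hs.2
    rw [mirror_cons, staysNonneg_append]
    refine ⟨by simpa [add_assoc] using this, ?_⟩
    simp only [StaysNonneg, List.sum_cons, Prod.snd_add, sum_mirror, reflect_apply]
    exact ⟨by have := hs.2.start_nonneg; linarith, by have := hs.1; linarith⟩

lemma reflect_mem_dyckSteps {v : ℤ × ℤ} (hv : v ∈ dyckSteps) : reflect v ∈ dyckSteps := by
  simp only [dyckSteps, Set.mem_insert_iff, Set.mem_singleton_iff] at hv ⊢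
  rcases hv with rfl | rfl <;> simp [reflect_apply]

lemma ballotNumber_succ_succ (p q : ℕ) :
    ballotNumber (p + 1) (q + 1) = ballotNumber (p + 1) q + ballotNumber p (q + 1) := by
  have h1 := Nat.choose_succ_right_eq (p + q + 1) p
  rw [show p + q + 1 - p = q + 1 by omega] at h1
  unfold ballotNumber
  rw [show p + 1 + (q + 1) = p + q + 1 + 1 by ring, Nat.choose_succ_succ,
    show p + 1 + q = p + q + 1 by ring, show p + (q + 1) = p + q + 1 by ring]
  have h1' : ((p + q + 1).choose (p + 1) : ℚ) * (p + 1) = (p + q + 1).choose p * (q + 1) := by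
    exact_mod_cast h1
  have hy : ((p + q + 1).choose (p + 1) : ℚ) = (p + q + 1).choose p * (q + 1) / (p + 1) := by
    rw [eq_div_iff (by positivity)]; exact h1'
  push_cast
  rw [Nat.succ_eq_add_one, hy]
  field_simp
  ring

/-- The step sequences of the Dyck paths with total displacement `B` which, started at height `h`,
stay nonnegative. -/
def nonnegDyckPaths (h : ℤ) (B : ℤ × ℤ) : Set (List (ℤ × ℤ)) :=
  {s | s ∈ latticePaths dyckSteps (0, 0) B ∧ StaysNonneg h s}

lemma nonnegDyckPaths_congr {h h' l l' k k' : ℤ} (hh : h = h') (hl : l = l') (hk : k = k') :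
    nonnegDyckPaths h (l, k) = nonnegDyckPaths h' (l', k') := by
  rw [hh, hl, hk]

lemma encard_nonnegDyckPaths_eq_add {h l k : ℤ} (hl : l ≠ 0) (hh : 0 ≤ h) :
    (nonnegDyckPaths h (l, k)).encard =
      (nonnegDyckPaths (h + 1) (l - 1, k - 1)).encard +
        (nonnegDyckPaths (h - 1) (l - 1, k + 1)).encard := by
  rw [encard_eq_sum_encard_cons_mem {((1 : ℤ), (1 : ℤ)), (1, -1)}, Finset.sum_pair (by simp)]
  · have hsub : h + -1 = h - 1 := rfl
    have e1 : (l, k) - ((1 : ℤ), (1 : ℤ)) = (l - 1, k - 1) := rfl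
    have e2 : (l, k) - ((1 : ℤ), (-1 : ℤ)) = (l - 1, k + 1) := by ext <;> simp
    simp only [nonnegDyckPaths, Set.mem_ofPred_eq, StaysNonneg, hh, true_and, hsub, e1, e2,
      cons_mem_latticePaths_zero (show ((1 : ℤ), (1 : ℤ)) ∈ dyckSteps by simp [dyckSteps]),
      cons_mem_latticePaths_zero (show ((1 : ℤ), (-1 : ℤ)) ∈ dyckSteps by simp [dyckSteps])]
  · rintro ⟨h1, -⟩
    exact hl (congrArg Prod.fst (mem_latticePaths_zero.1 h1).2).symm
  · intro v s hs
    have := (mem_latticePaths_zero.1 hs.1).1 v (by simp)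
    simpa [dyckSteps] using this

/-- The number of Dyck paths from height `p - q` down to height `0` in `p + q` steps which stay
nonnegative; for `q = p + 1` the start is negative, and both sides vanish. -/
lemma exists_encard_nonnegPaths_eq_ballotNumber (m : ℕ) : ∀ p q : ℕ, p + q = m → q ≤ p + 1 →
    ∃ c : ℕ, (nonnegDyckPaths ((p : ℤ) - q) ((p : ℤ) + q, (q : ℤ) - p)).encard = c ∧
      (c : ℚ) = ballotNumber p q := by
  induction m with
  | zero =>
    intro p q h _
    obtain ⟨rfl, rfl⟩ : p = 0 ∧ q = 0 := by omega
    refine ⟨1, ?_, by norm_num [ballotNumber]⟩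
    rw [Nat.cast_one, Set.encard_eq_one]
    refine ⟨[], ?_⟩
    ext s
    simp only [nonnegDyckPaths, mem_latticePaths_zero, Set.mem_ofPred_eq, Set.mem_singleton_iff]
    constructor
    · rintro ⟨⟨h1, h2⟩, -⟩
      cases s with
      | nil => rfl
      | cons v s =>
        have hpos : ∀ w ∈ v :: s, 1 ≤ w.1 := by
          intro w hw
          rcases h1 w hw with rfl | h
          · simp
          · rw [Set.mem_singleton_iff.1 h]
        have h3 := fst_sum_nonneg fun w hw => zero_le_one.trans (hpos w (List.mem_cons_of_mem v hw))
        have h4 := hpos v (by simp)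
        have h5 := congrArg Prod.fst h2
        simp at h5
        omega
    · rintro rfl
      simp [StaysNonneg, Prod.mk_zero_zero]
  | succ m ih =>
    intro p q h hqp
    rcases hqp.lt_or_eq with hlt | rfl
    · rw [encard_nonnegDyckPaths_eq_add (by omega) (by omega)]
      rcases q with _ | q
      · obtain rfl : p = m + 1 := by omega
        obtain ⟨c, hc, hcb⟩ := ih m 0 rfl (by omega)
        refine ⟨c, ?_, ?_⟩
        · -- all `m + 1` steps are descents, so no path begins with an ascent
          have hempty : nonnegDyckPaths (((m + 1 : ℕ) : ℤ) - (0 : ℕ) + 1)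
              (((m + 1 : ℕ) : ℤ) + (0 : ℕ) - 1, ((0 : ℕ) : ℤ) - (m + 1 : ℕ) - 1) = ∅ := by
            rw [Set.eq_empty_iff_forall_notMem]
            rintro s ⟨hs, -⟩
            obtain ⟨hs, hsum⟩ := mem_latticePaths_zero.1 hs
            have := fst_add_snd_sum_nonneg fun v hv => show 0 ≤ v.1 + v.2 by
              rcases hs v hv with rfl | h
              · simp
              · rw [Set.mem_singleton_iff.1 h]; simp
            rw [hsum] at this
            push_cast at this
            omega
          rw [hempty, Set.encard_empty, zero_add, ← hc]
          rw [nonnegDyckPaths_congr] <;> omega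
        · rw [hcb]
          have h1 : (m : ℚ) + 1 ≠ 0 := by positivity
          have h2 : (m : ℚ) + 1 + 1 ≠ 0 := by positivity
          simp [ballotNumber, h1, h2]
      · obtain ⟨p, rfl⟩ : ∃ p', p = p' + 1 := ⟨p - 1, by omega⟩
        obtain ⟨c, hc, hcb⟩ := ih (p + 1) q (by omega) (by omega)
        obtain ⟨d, hd, hdb⟩ := ih p (q + 1) (by omega) (by omega)
        refine ⟨c + d, ?_, ?_⟩
        · rw [Nat.cast_add (R := ℕ∞), ← hc, ← hd]
          congr 2 <;> exact nonnegDyckPaths_congr (by omega) (by omega) (by omega)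
        · rw [Nat.cast_add, hcb, hdb, ballotNumber_succ_succ]
    · refine ⟨0, ?_, by simp [ballotNumber]⟩
      rw [Nat.cast_zero, Set.encard_eq_zero, Set.eq_empty_iff_forall_notMem]
      rintro s ⟨-, hs⟩
      have := hs.start_nonneg
      push_cast at this
      omega

/-! ### Polygonal curves -/

lemma mem_segment_toPlane {A v : ℤ × ℤ} {P : ℝ × ℝ} :
    P ∈ segment ℝ (toPlane A) (toPlane (A + v)) ↔
      ∃ t : ℝ, 0 ≤ t ∧ t ≤ 1 ∧ P = ((A.1 : ℝ) + t * v.1, (A.2 : ℝ) + t * v.2) := by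
  rw [segment_eq_image']
  simp only [Set.mem_image, Set.mem_Icc, and_assoc]
  refine exists_congr fun t => and_congr_right fun _ => and_congr_right fun _ => ?_
  rw [eq_comm]
  simp [toPlane, Prod.ext_iff]

lemma toPlane_mem_pathTrace (A : ℤ × ℤ) (s : List (ℤ × ℤ)) : toPlane A ∈ pathTrace A s := by
  cases s with
  | nil => rfl
  | cons v s => exact Or.inl (left_mem_segment _ _ _)

lemma pathTrace_append (A : ℤ × ℤ) (s t : List (ℤ × ℤ)) :
    pathTrace A (s ++ t) = pathTrace A s ∪ pathTrace (A + s.sum) t := by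
  induction s generalizing A with
  | nil =>
    simp only [List.nil_append, List.sum_nil, add_zero, pathTrace]
    rw [Set.union_eq_self_of_subset_left]
    exact Set.singleton_subset_iff.2 (toPlane_mem_pathTrace A t)
  | cons v s ih =>
    simp only [List.cons_append, pathTrace, ih, List.sum_cons, Set.union_assoc, add_assoc]

lemma segment_subset_pathTrace (A v : ℤ × ℤ) (s t : List (ℤ × ℤ)) :
    segment ℝ (toPlane (A + s.sum)) (toPlane (A + s.sum + v)) ⊆ pathTrace A (s ++ v :: t) := by
  rw [pathTrace_append]
  exact fun P hP => Or.inr (Or.inl hP)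

lemma mem_pathTrace {A : ℤ × ℤ} {s : List (ℤ × ℤ)} {P : ℝ × ℝ} (h : P ∈ pathTrace A s) :
    P = toPlane A ∨ ∃ s₁ v s₂, s = s₁ ++ v :: s₂ ∧
      P ∈ segment ℝ (toPlane (A + s₁.sum)) (toPlane (A + s₁.sum + v)) := by
  induction s generalizing A with
  | nil => exact Or.inl h
  | cons w s ih =>
    refine Or.inr ?_
    rcases h with h | h
    · exact ⟨[], w, s, rfl, by simpa using h⟩
    · rcases ih h with rfl | ⟨s₁, v, s₂, rfl, hP⟩
      · exact ⟨[], w, s, rfl, by simpa using right_mem_segment ℝ _ _⟩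
      · exact ⟨w :: s₁, v, s₂, rfl, by simpa [add_assoc] using hP⟩

lemma toPlane_injective : Function.Injective toPlane := by
  intro A B h
  simp only [toPlane, Prod.mk.injEq, Int.cast_inj] at h
  exact Prod.ext h.1 h.2

/-- A Schröder step contains no lattice point besides its endpoints and, for a horizontal step,
its midpoint. -/
lemma toPlane_mem_segment_schroeder {A v Q : ℤ × ℤ} (hv : v ∈ schroederSteps) :
    toPlane Q ∈ segment ℝ (toPlane A) (toPlane (A + v)) ↔
      Q = A ∨ Q = A + v ∨ v = (2, 0) ∧ Q = A + (1, 0) := by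
  constructor
  · rw [mem_segment_toPlane]
    rintro ⟨t, ht0, ht1, h⟩
    simp only [toPlane, Prod.mk.injEq] at h
    obtain ⟨h1, h2⟩ := h
    have hm : (((Q.1 - A.1 : ℤ)) : ℝ) = t * v.1 := by push_cast; linarith
    simp only [schroederSteps, Set.mem_insert_iff, Set.mem_singleton_iff] at hv
    simp only [Prod.ext_iff, Prod.fst_add, Prod.snd_add]
    rcases hv with rfl | rfl | rfl
    · have hn : (((Q.2 - A.2 : ℤ)) : ℝ) = t := by push_cast at h2 ⊢; linarith
      have hm : (((Q.1 - A.1 : ℤ)) : ℝ) = t := by push_cast at hm ⊢; linarith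
      have he : Q.1 - A.1 = Q.2 - A.2 := by exact_mod_cast hm.trans hn.symm
      have h0 : 0 ≤ Q.1 - A.1 := by exact_mod_cast hm ▸ ht0
      have h1 : Q.1 - A.1 ≤ 1 := by exact_mod_cast hm ▸ ht1
      simp
      omega
    · have hn : (((A.2 - Q.2 : ℤ)) : ℝ) = t := by push_cast at h2 ⊢; linarith
      have hm : (((Q.1 - A.1 : ℤ)) : ℝ) = t := by push_cast at hm ⊢; linarith
      have he : Q.1 - A.1 = A.2 - Q.2 := by exact_mod_cast hm.trans hn.symm
      have h0 : 0 ≤ Q.1 - A.1 := by exact_mod_cast hm ▸ ht0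
      have h1 : Q.1 - A.1 ≤ 1 := by exact_mod_cast hm ▸ ht1
      simp
      omega
    · have hn : Q.2 = A.2 := by
        push_cast at h2
        have : (Q.2 : ℝ) = A.2 := by linarith
        exact_mod_cast this
      have h0 : 0 ≤ Q.1 - A.1 := by
        have : (0 : ℝ) ≤ ((Q.1 - A.1 : ℤ) : ℝ) := by rw [hm]; push_cast; linarith
        exact_mod_cast this
      have h1 : Q.1 - A.1 ≤ 2 := by
        have : ((Q.1 - A.1 : ℤ) : ℝ) ≤ 2 := by rw [hm]; push_cast; linarith
        exact_mod_cast this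
      simp
      omega
  · rintro (rfl | rfl | ⟨rfl, rfl⟩)
    · exact left_mem_segment _ _ _
    · exact right_mem_segment _ _ _
    · rw [mem_segment_toPlane]
      exact ⟨1 / 2, by norm_num, by norm_num, by simp [toPlane]⟩

/-- The lattice points on a Schröder path are its vertices and the midpoints of its horizontal
steps. -/
lemma toPlane_mem_pathTrace_schroeder {A Q : ℤ × ℤ} {s : List (ℤ × ℤ)}
    (hs : ∀ v ∈ s, v ∈ schroederSteps) :
    toPlane Q ∈ pathTrace A s ↔ (∃ s₁ s₂, s = s₁ ++ s₂ ∧ Q = A + s₁.sum) ∨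
      ∃ s₁ s₂, s = s₁ ++ (2, 0) :: s₂ ∧ Q = A + s₁.sum + (1, 0) := by
  constructor
  · intro h
    rcases mem_pathTrace h with h | ⟨s₁, v, s₂, rfl, hseg⟩
    · exact Or.inl ⟨[], s, rfl, by simpa using toPlane_injective h⟩
    · rcases (toPlane_mem_segment_schroeder (hs v (by simp))).1 hseg with rfl | rfl | ⟨rfl, rfl⟩
      · exact Or.inl ⟨s₁, _, rfl, rfl⟩
      · exact Or.inl ⟨s₁ ++ [v], s₂, by simp, by simp [add_assoc]⟩
      · exact Or.inr ⟨s₁, s₂, rfl, rfl⟩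
  · rintro (⟨s₁, s₂, rfl, rfl⟩ | ⟨s₁, s₂, rfl, rfl⟩)
    · rw [pathTrace_append]
      exact Or.inr (toPlane_mem_pathTrace _ _)
    · exact segment_subset_pathTrace _ _ _ _
        ((toPlane_mem_segment_schroeder (hs _ (by simp))).2 (Or.inr (Or.inr ⟨rfl, rfl⟩)))

/-! ### The regions -/

lemma add_smul_mem_pathTrace_replicate (A v : ℤ × ℤ) (m : ℕ) {t : ℝ} (h0 : 0 ≤ t) (h1 : t ≤ m) :
    ((A.1 : ℝ) + t * v.1, (A.2 : ℝ) + t * v.2) ∈ pathTrace A (List.replicate m v) := by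
  induction m generalizing A t with
  | zero =>
    obtain rfl : t = 0 := le_antisymm (by simpa using h1) h0
    simp [pathTrace, toPlane]
  | succ m ih =>
    rw [List.replicate_succ, pathTrace]
    by_cases ht : t ≤ 1
    · exact Or.inl (mem_segment_toPlane.2 ⟨t, h0, ht, rfl⟩)
    · refine Or.inr ?_
      push_cast at h1
      convert ih (A + v) (t := t - 1) (by linarith) (by linarith) using 2 <;>
      · simp only [Prod.fst_add, Prod.snd_add, Int.cast_add]
        ring

lemma mem_pathTrace_maxPath (n : ℕ) {x : ℝ} (h0 : 0 ≤ x) (h1 : x ≤ 2 * n) :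
    (x, min x (2 * n - x)) ∈ pathTrace (0, 0) (maxPath n) := by
  rw [maxPath, pathTrace_append]
  rcases le_total x n with h | h
  · left
    convert add_smul_mem_pathTrace_replicate (0, 0) (1, 1) n h0 h using 2
    · simp
    · rw [min_eq_left (by linarith)]; simp
  · right
    convert add_smul_mem_pathTrace_replicate _ (1, -1) n (t := x - n) (by linarith) (by linarith)
      using 2
    · simp
    · rw [min_eq_right (by linarith)]; simp; ring

lemma mem_pathTrace_minPath (n : ℕ) {x : ℝ} (h0 : 0 ≤ x) (h1 : x ≤ 2 * n) :
    (x, -min x (2 * n - x)) ∈ pathTrace (0, 0) (minPath n) := by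
  rw [minPath, pathTrace_append]
  rcases le_total x n with h | h
  · left
    convert add_smul_mem_pathTrace_replicate (0, 0) (1, -1) n h0 h using 2
    · simp
    · rw [min_eq_left (by linarith)]; simp
  · right
    convert add_smul_mem_pathTrace_replicate _ (1, 1) n (t := x - n) (by linarith) (by linarith)
      using 2
    · simp
    · rw [min_eq_right (by linarith)]; simp; ring

lemma dyckSteps_subset_schroederSteps : dyckSteps ⊆ schroederSteps := by
  simp [dyckSteps, schroederSteps, Set.insert_subset_iff]

lemma abs_snd_le_fst_of_mem_schroederSteps {v : ℤ × ℤ} (hv : v ∈ schroederSteps) :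
    |v.2| ≤ v.1 := by
  simp only [schroederSteps, Set.mem_insert_iff, Set.mem_singleton_iff] at hv
  rcases hv with rfl | rfl | rfl <;> simp

lemma abs_snd_sum_le_fst_sum {s : List (ℤ × ℤ)} (hs : ∀ v ∈ s, v ∈ schroederSteps) :
    |s.sum.2| ≤ s.sum.1 := by
  induction s with
  | nil => simp
  | cons v s ih =>
    simp only [List.mem_cons, forall_eq_or_imp] at hs
    have h1 := ih hs.2
    have h2 := abs_snd_le_fst_of_mem_schroederSteps hs.1
    simp only [List.sum_cons, Prod.fst_add, Prod.snd_add]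
    exact (abs_add_le _ _).trans (by linarith)

/-- A Schröder path has slopes between `-1` and `1`, so it lies in the cones issuing from its
endpoints. -/
lemma mem_cones_of_mem_pathTrace {A : ℤ × ℤ} {s : List (ℤ × ℤ)}
    (hs : ∀ v ∈ s, v ∈ schroederSteps) {P : ℝ × ℝ} (hP : P ∈ pathTrace A s) :
    |P.2 - A.2| ≤ P.1 - A.1 ∧
      |((A + s.sum).2 : ℝ) - P.2| ≤ ((A + s.sum).1 : ℝ) - P.1 := by
  have hcast : ∀ {w : ℤ × ℤ}, |w.2| ≤ w.1 → |(w.2 : ℝ)| ≤ w.1 := fun h => by exact_mod_cast h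
  have hsum : ∀ {s : List (ℤ × ℤ)}, (∀ v ∈ s, v ∈ schroederSteps) → |(s.sum.2 : ℝ)| ≤ s.sum.1 :=
    fun h => hcast (abs_snd_sum_le_fst_sum h)
  rcases mem_pathTrace hP with rfl | ⟨s₁, v, s₂, rfl, h⟩
  · simpa [toPlane] using hsum hs
  · obtain ⟨t, ht0, ht1, rfl⟩ := mem_segment_toPlane.1 h
    simp only [List.mem_append, List.mem_cons] at hs
    have h1 := abs_le.1 (hsum fun v hv => hs v (Or.inl hv))
    have h2 := abs_le.1 (hsum fun v hv => hs v (Or.inr (Or.inr hv)))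
    have h3 := abs_le.1 (hcast (abs_snd_le_fst_of_mem_schroederSteps (hs v (by simp))))
    simp only [List.sum_append, List.sum_cons, Prod.fst_add, Prod.snd_add, Int.cast_add]
    have h4 := mul_le_mul_of_nonneg_left h3.1 ht0
    have h5 := mul_le_mul_of_nonneg_left h3.2 ht0
    have h6 := mul_le_mul_of_nonneg_left h3.1 (sub_nonneg.2 ht1)
    have h7 := mul_le_mul_of_nonneg_left h3.2 (sub_nonneg.2 ht1)
    refine ⟨abs_le.2 ⟨?_, ?_⟩, abs_le.2 ⟨?_, ?_⟩⟩ <;> linarith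

lemma pathTrace_subset_region {n : ℕ} {s : List (ℤ × ℤ)}
    (hs : s ∈ latticePaths schroederSteps (0, 0) (2 * (n : ℤ), 0)) :
    pathTrace (0, 0) s ⊆
      closedRegionBetween (pathTrace (0, 0) (minPath n)) (pathTrace (0, 0) (maxPath n)) := by
  intro P hP
  obtain ⟨hs, hsum⟩ := hs
  obtain ⟨h1, h2⟩ := mem_cones_of_mem_pathTrace hs hP
  rw [hsum] at h2
  rw [abs_le] at h1 h2
  push_cast at h1 h2
  obtain ⟨h1, h1'⟩ := h1
  obtain ⟨h2, h2'⟩ := h2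
  have h3 : 0 ≤ P.1 := by linarith
  have h4 : P.1 ≤ 2 * n := by linarith
  refine ⟨_, _, mem_pathTrace_minPath n h3 h4, mem_pathTrace_maxPath n h3 h4, ?_, ?_⟩
  · rw [neg_le]
    exact le_min (by linarith) (by linarith)
  · exact le_min (by linarith) (by linarith)

/-- By convexity, it suffices to look at the vertices. -/
lemma staysNonneg_iff_pathTrace {A : ℤ × ℤ} {s : List (ℤ × ℤ)} :
    StaysNonneg A.2 s ↔ ∀ P ∈ pathTrace A s, 0 ≤ P.2 := by
  induction s generalizing A with
  | nil => simp [StaysNonneg, pathTrace, toPlane]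
  | cons v s ih =>
    rw [StaysNonneg, ← Prod.snd_add, ih]
    constructor
    · rintro ⟨h1, h2⟩ P (hP | hP)
      · obtain ⟨t, ht0, ht1, rfl⟩ := mem_segment_toPlane.1 hP
        have h3 := h2 _ (toPlane_mem_pathTrace (A + v) s)
        have h1' : (0 : ℝ) ≤ A.2 := by exact_mod_cast h1
        simp only [toPlane, Prod.snd_add, Int.cast_add] at h3
        nlinarith
      · exact h2 P hP
    · intro h
      refine ⟨?_, fun P hP => h P (Or.inr hP)⟩
      have := h _ (Or.inl (left_mem_segment _ _ _))
      simpa [toPlane] using this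

lemma zigzagPath_add (m k : ℕ) : zigzagPath (m + k) = zigzagPath m ++ zigzagPath k := by
  rw [zigzagPath, List.replicate_add, List.flatten_append]; rfl

lemma zigzagPath_succ (m : ℕ) : zigzagPath (m + 1) = (1, 1) :: (1, -1) :: zigzagPath m := by
  simp [zigzagPath, List.replicate_succ]

lemma sum_zigzagPath (m : ℕ) : (zigzagPath m).sum = (2 * (m : ℤ), 0) := by
  induction m with
  | zero => rfl
  | succ m ih =>
    rw [zigzagPath_succ, List.sum_cons, List.sum_cons, ih]
    ext <;> simp
    ring

lemma staysNonneg_zigzagPath (m : ℕ) : StaysNonneg 0 (zigzagPath m) := by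
  induction m with
  | zero => simp [zigzagPath, StaysNonneg]
  | succ m ih => simpa [zigzagPath_succ, StaysNonneg] using ih

lemma up_mem_pathTrace_zigzagPath {n i : ℕ} (hi : i < n) {t : ℝ} (h0 : 0 ≤ t) (h1 : t ≤ 1) :
    (2 * (i : ℝ) + t, t) ∈ pathTrace (0, 0) (zigzagPath n) := by
  obtain ⟨k, rfl⟩ := Nat.exists_eq_add_of_lt hi
  rw [show i + k + 1 = i + (k + 1) by ring, zigzagPath_add, zigzagPath_succ]
  refine segment_subset_pathTrace _ _ _ _ (mem_segment_toPlane.2 ⟨t, h0, h1, ?_⟩)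
  simp [sum_zigzagPath]

lemma down_mem_pathTrace_zigzagPath {n i : ℕ} (hi : i < n) {t : ℝ} (h0 : 0 ≤ t) (h1 : t ≤ 1) :
    (2 * (i : ℝ) + 1 + t, 1 - t) ∈ pathTrace (0, 0) (zigzagPath n) := by
  obtain ⟨k, rfl⟩ := Nat.exists_eq_add_of_lt hi
  rw [show i + k + 1 = i + (k + 1) by ring, zigzagPath_add, zigzagPath_succ]
  have e : zigzagPath i ++ (1, 1) :: (1, -1) :: zigzagPath k =
    (zigzagPath i ++ [(1, 1)]) ++ (1, -1) :: zigzagPath k := by simp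
  rw [e]
  refine segment_subset_pathTrace _ _ _ _ (mem_segment_toPlane.2 ⟨t, h0, h1, ?_⟩)
  simp [sum_zigzagPath, sub_eq_add_neg]

/-- Vertices of Schröder paths from the origin have even coordinate sum. -/
lemma even_fst_add_snd_sum {s : List (ℤ × ℤ)} (hs : ∀ v ∈ s, v ∈ schroederSteps) :
    Even (s.sum.1 + s.sum.2) := by
  induction s with
  | nil => simp
  | cons v s ih =>
    simp only [List.mem_cons, forall_eq_or_imp] at hs
    have h1 := ih hs.2
    have h2 : Even (v.1 + v.2) := by
      have := hs.1
      simp only [schroederSteps, Set.mem_insert_iff, Set.mem_singleton_iff] at this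
      rcases this with rfl | rfl | rfl <;> decide
    simp only [List.sum_cons, Prod.fst_add, Prod.snd_add]
    have := h2.add h1
    rwa [add_add_add_comm] at this

/-- A Dyck path lies above the zigzag path as soon as it stays nonnegative, because its vertices
with odd abscissa have odd height. -/
lemma pathTrace_subset_zigzag_region_iff {n : ℕ} {s : List (ℤ × ℤ)}
    (hs : s ∈ latticePaths dyckSteps (0, 0) (2 * (n : ℤ), 0)) :
    pathTrace (0, 0) s ⊆
      closedRegionBetween (pathTrace (0, 0) (zigzagPath n)) (pathTrace (0, 0) (maxPath n)) ↔
    StaysNonneg 0 s := by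
  constructor
  · intro h
    refine (staysNonneg_iff_pathTrace (A := (0, 0))).2 fun P hP => ?_
    obtain ⟨a, b, ha, -, hab, -⟩ := h hP
    exact ((staysNonneg_iff_pathTrace (A := (0, 0))).1 (staysNonneg_zigzagPath n) _ ha).trans hab
  · intro h P hP
    have hsch : s ∈ latticePaths schroederSteps (0, 0) (2 * (n : ℤ), 0) :=
      ⟨fun v hv => dyckSteps_subset_schroederSteps (hs.1 v hv), hs.2⟩
    obtain ⟨-, b, -, hb, -, hPb⟩ := pathTrace_subset_region hsch hP
    suffices H : ∃ a, (P.1, a) ∈ pathTrace (0, 0) (zigzagPath n) ∧ a ≤ P.2 by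
      obtain ⟨a, ha, haP⟩ := H
      exact ⟨a, b, ha, hb, haP, hPb⟩
    rcases mem_pathTrace hP with rfl | ⟨s₁, v, s₂, rfl, hPv⟩
    · exact ⟨0, by simpa [toPlane] using toPlane_mem_pathTrace (0, 0) (zigzagPath n),
        by simp [toPlane]⟩
    · obtain ⟨t, ht0, ht1, rfl⟩ := mem_segment_toPlane.1 hPv
      have hsteps := hsch.1
      simp only [List.mem_append, List.mem_cons] at hsteps
      have hx₁ := abs_snd_sum_le_fst_sum fun v hv => hsteps v (Or.inl hv)
      have hx₂ := abs_snd_sum_le_fst_sum fun v hv => hsteps v (Or.inr (Or.inr hv))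
      have heven := even_fst_add_snd_sum fun v hv => hsteps v (Or.inl hv)
      have hx₁' := (abs_nonneg _).trans hx₁
      have hx₂' := (abs_nonneg _).trans hx₂
      have hv : v ∈ dyckSteps := hs.1 v (by simp)
      have hvx : v.1 = 1 := by
        rcases hv with rfl | h
        · rfl
        · rw [Set.mem_singleton_iff.1 h]
      have htot := congrArg Prod.fst hs.2
      simp only [List.sum_append, List.sum_cons, Prod.fst_add, hvx, zero_add] at htot
      have hy := (staysNonneg_append.1 h).2
      have hy₁ := hy.1
      have hy₂ := hy.2.start_nonneg
      rw [zero_add] at hy₁ hy₂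
      have hvy : v.2 = 1 ∨ v.2 = -1 := by
        rcases hv with rfl | h
        · exact Or.inl rfl
        · rw [Set.mem_singleton_iff.1 h]; exact Or.inr rfl
      simp only [Prod.fst_add, Prod.snd_add, zero_add, hvx, Int.cast_one, mul_one]
      rcases Int.even_or_odd' s₁.sum.1 with ⟨j, hj | hj⟩
      · -- over `[2 j, 2 j + 1]` the zigzag path ascends from `0` to `1`
        obtain ⟨i, rfl⟩ := Int.eq_ofNat_of_zero_le (show 0 ≤ j by omega)
        refine ⟨t, ?_, ?_⟩
        · convert up_mem_pathTrace_zigzagPath (n := n) (i := i) (by omega) ht0 ht1 using 2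
          rw [hj]; push_cast; ring
        · have h1 : 1 ≤ s₁.sum.2 + v.2 := by
            rw [hj] at heven
            rcases heven with ⟨r, hr⟩
            omega
          have h1' : (1 : ℝ) ≤ s₁.sum.2 + v.2 := by exact_mod_cast h1
          have h2' : (0 : ℝ) ≤ s₁.sum.2 := by exact_mod_cast hy₁
          nlinarith
      · -- over `[2 j + 1, 2 j + 2]` the zigzag path descends from `1` to `0`
        obtain ⟨i, rfl⟩ := Int.eq_ofNat_of_zero_le (show 0 ≤ j by omega)
        refine ⟨1 - t, ?_, ?_⟩
        · convert down_mem_pathTrace_zigzagPath (n := n) (i := i) (by omega) ht0 ht1 using 2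
          rw [hj]; push_cast; ring
        · have h1 : 1 ≤ s₁.sum.2 := by
            rw [hj] at heven
            rcases heven with ⟨r, hr⟩
            omega
          have h1' : (1 : ℝ) ≤ s₁.sum.2 := by exact_mod_cast h1
          have h2' : (0 : ℝ) ≤ s₁.sum.2 + v.2 := by exact_mod_cast hy₂
          nlinarith

/-! ### Splitting paths at the middle line -/

lemma fst_pos_of_mem_schroederSteps {v : ℤ × ℤ} (hv : v ∈ schroederSteps) : 0 < v.1 := by
  simp only [schroederSteps, Set.mem_insert_iff, Set.mem_singleton_iff] at hv
  rcases hv with rfl | rfl | rfl <;> simp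

lemma eq_nil_of_fst_sum_eq_zero {s : List (ℤ × ℤ)} (hs : ∀ v ∈ s, 0 < v.1) (h : s.sum.1 = 0) :
    s = [] := by
  cases s with
  | nil => rfl
  | cons v s =>
    simp only [List.mem_cons, forall_eq_or_imp] at hs
    have := fst_sum_nonneg fun w hw => (hs.2 w hw).le
    simp only [List.sum_cons, Prod.fst_add] at h
    omega

/-- A path whose steps advance to the right is determined by its part up to a given vertical line
and the remaining part. -/
lemma ncard_image2_append {X Y : Set (List (ℤ × ℤ))} {l : ℤ}
    (hX : ∀ s ∈ X, (∀ v ∈ s, 0 < v.1) ∧ s.sum.1 = l) :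
    (Set.image2 (· ++ ·) X Y).ncard = X.ncard * Y.ncard := by
  rw [← Set.ncard_prod, ← Set.image_prod]
  refine Set.InjOn.ncard_image ?_
  rintro ⟨s, t⟩ ⟨hs, -⟩ ⟨s', t'⟩ ⟨hs', -⟩ h
  obtain ⟨hpos, hl⟩ := hX s hs
  obtain ⟨hpos', hl'⟩ := hX s' hs'
  rcases List.append_eq_append_iff.1 h with ⟨r, hr, hr'⟩ | ⟨r, hr, hr'⟩
  · dsimp only at hr hr' hpos' hl hl'
    subst hr hr'
    obtain rfl := eq_nil_of_fst_sum_eq_zero (s := r) (fun v hv => hpos' v (by simp [hv])) (by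
      simp only [List.sum_append, Prod.fst_add] at hl'; omega)
    simp
  · dsimp only at hr hr' hpos hl hl'
    subst hr hr'
    obtain rfl := eq_nil_of_fst_sum_eq_zero (s := r) (fun v hv => hpos v (by simp [hv])) (by
      simp only [List.sum_append, Prod.fst_add] at hl; omega)
    simp

lemma ncard_latticePaths_reflect {S : Set (ℤ × ℤ)} (hS : reflect '' S = S) (l k : ℤ) :
    (latticePaths S (0, 0) (l, -k)).ncard = (latticePaths S (0, 0) (l, k)).ncard := by
  have := ncard_latticePaths_image reflect reflect_injective S (l, k)
  rwa [hS] at this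

lemma reflect_image_dyckSteps : reflect '' dyckSteps = dyckSteps := by
  simp [dyckSteps, Set.image_insert_eq, reflect_apply, Set.pair_comm]

lemma reflect_image_schroederSteps : reflect '' schroederSteps = schroederSteps := by
  simp [schroederSteps, Set.image_insert_eq, reflect_apply, Set.insert_comm]

/-- The paths that have a vertex at `(n, k)` consist of two paths that are counted by the same
number, by reflection. -/
lemma countPathsThrough_eq_sq {S : Set (ℤ × ℤ)} (hS : S ⊆ schroederSteps)
    (hrefl : reflect '' S = S) {n : ℕ} {k : ℤ} (h : Even ((n : ℤ) + k) ∨ (2, 0) ∉ S) :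
    countPathsThrough S (0, 0) (2 * (n : ℤ), 0) (minPath n) (maxPath n) n k =
      (latticePaths S (0, 0) ((n : ℤ), k)).ncard ^ 2 := by
  rw [sq]
  nth_rw 2 [← ncard_latticePaths_reflect hrefl]
  rw [← ncard_image2_append (l := n), countPathsThrough]
  · congr 1
    ext s
    simp only [Set.mem_ofPred_eq, Set.mem_image2]
    constructor
    · rintro ⟨⟨hs, hsum⟩, -, hmem⟩
      rw [toPlane_mem_pathTrace_schroeder fun v hv => hS (hs v hv)] at hmem
      rcases hmem with ⟨s₁, s₂, rfl, h1⟩ | ⟨s₁, s₂, rfl, h1⟩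
      · simp only [List.mem_append] at hs
        rw [Prod.mk_zero_zero, zero_add] at h1 hsum
        refine ⟨s₁, ⟨fun v hv => hs v (Or.inl hv), ?_⟩, s₂, ⟨fun v hv => hs v (Or.inr hv), ?_⟩, rfl⟩
        · rw [Prod.mk_zero_zero, zero_add, h1]
        · rw [List.sum_append, ← h1] at hsum
          rw [Prod.mk_zero_zero, zero_add, eq_sub_of_add_eq' hsum]
          ext <;> simp; ring
      · exfalso
        simp only [List.mem_append, List.mem_cons] at hs
        rcases h with h | h
        · have h2 := even_fst_add_snd_sum fun v hv => hS (hs v (Or.inl hv))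
          rw [Prod.mk_zero_zero, zero_add] at h1
          have h3 := congrArg Prod.fst h1
          have h4 := congrArg Prod.snd h1
          simp only [Prod.fst_add, Prod.snd_add, add_zero] at h3 h4
          obtain ⟨a, ha⟩ := h
          obtain ⟨b, hb⟩ := h2
          omega
        · exact h (hs _ (by simp))
    · rintro ⟨s₁, h₁, s₂, h₂, rfl⟩
      obtain ⟨h₁, hsum₁⟩ := mem_latticePaths_zero.1 h₁
      obtain ⟨h₂, hsum₂⟩ := mem_latticePaths_zero.1 h₂
      have hmem : ∀ v ∈ s₁ ++ s₂, v ∈ S := by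
        intro v hv
        rcases List.mem_append.1 hv with hv | hv
        · exact h₁ v hv
        · exact h₂ v hv
      have hsum : (0, 0) + (s₁ ++ s₂).sum = (2 * (n : ℤ), 0) := by
        rw [List.sum_append, hsum₁, hsum₂]
        ext <;> simp; ring
      refine ⟨⟨hmem, hsum⟩, pathTrace_subset_region ⟨fun v hv => hS (hmem v hv), hsum⟩, ?_⟩
      rw [toPlane_mem_pathTrace_schroeder fun v hv => hS (hmem v hv)]
      exact Or.inl ⟨s₁, s₂, rfl, by rw [Prod.mk_zero_zero, zero_add, hsum₁]⟩
  · intro s hs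
    obtain ⟨hs, hsum⟩ := mem_latticePaths_zero.1 hs
    exact ⟨fun v hv => fst_pos_of_mem_schroederSteps (hS (hs v hv)), by rw [hsum]⟩

lemma schroederCount_of_even {n : ℕ} {k : ℤ} (h : Even ((n : ℤ) + k)) :
    schroederCount n k = (latticePaths schroederSteps (0, 0) ((n : ℤ), k)).ncard ^ 2 :=
  countPathsThrough_eq_sq subset_rfl reflect_image_schroederSteps (Or.inl h)

lemma dyckCount_eq_sq (n : ℕ) (k : ℤ) :
    dyckCount n k = (latticePaths dyckSteps (0, 0) ((n : ℤ), k)).ncard ^ 2 :=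
  countPathsThrough_eq_sq dyckSteps_subset_schroederSteps reflect_image_dyckSteps
    (Or.inr (by simp [dyckSteps]))

/-- If `n + k` is odd, then `(n, k)` can only be the midpoint of a horizontal step. -/
lemma schroederCount_of_not_even {n : ℕ} {k : ℤ} (h : ¬ Even ((n : ℤ) + k)) :
    schroederCount n k = (latticePaths schroederSteps (0, 0) ((n : ℤ) - 1, k)).ncard ^ 2 := by
  rw [sq]
  nth_rw 2 [← ncard_latticePaths_reflect reflect_image_schroederSteps]
  rw [← Set.ncard_image_of_injective (latticePaths schroederSteps (0, 0) ((n : ℤ) - 1, -k))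
      (List.cons_injective (a := ((2 : ℤ), (0 : ℤ)))),
    ← ncard_image2_append (l := (n : ℤ) - 1), schroederCount, countPathsThrough]
  · congr 1
    ext s
    simp only [Set.mem_ofPred_eq, Set.mem_image2]
    constructor
    · rintro ⟨⟨hs, hsum⟩, -, hmem⟩
      rw [toPlane_mem_pathTrace_schroeder hs] at hmem
      rcases hmem with ⟨s₁, s₂, rfl, h1⟩ | ⟨s₁, s₂, rfl, h1⟩
      · exfalso
        simp only [List.mem_append] at hs
        have h2 := even_fst_add_snd_sum fun v hv => hs v (Or.inl hv)
        rw [Prod.mk_zero_zero, zero_add] at h1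
        rw [← h1] at h2
        exact h h2
      · simp only [List.mem_append, List.mem_cons] at hs
        rw [Prod.mk_zero_zero, zero_add] at h1 hsum
        have hs₁ : s₁.sum = ((n : ℤ) - 1, k) := by
          rw [eq_sub_of_add_eq h1.symm]
          ext <;> simp
        refine ⟨s₁, ⟨fun v hv => hs v (Or.inl hv), ?_⟩, _,
          ⟨s₂, ⟨fun v hv => hs v (Or.inr (Or.inr hv)), ?_⟩, rfl⟩, rfl⟩
        · rw [Prod.mk_zero_zero, zero_add, hs₁]
        · rw [List.sum_append, List.sum_cons, hs₁, Prod.ext_iff] at hsum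
          simp only [Prod.fst_add, Prod.snd_add] at hsum
          rw [Prod.mk_zero_zero, zero_add, Prod.ext_iff]
          constructor <;> dsimp only <;> omega
    · rintro ⟨s₁, h₁, _, ⟨s₂, h₂, rfl⟩, rfl⟩
      obtain ⟨h₁, hsum₁⟩ := mem_latticePaths_zero.1 h₁
      obtain ⟨h₂, hsum₂⟩ := mem_latticePaths_zero.1 h₂
      have hmem : ∀ v ∈ s₁ ++ (2, 0) :: s₂, v ∈ schroederSteps := by
        intro v hv
        rcases List.mem_append.1 hv with hv | hv
        · exact h₁ v hv
        · rcases List.mem_cons.1 hv with rfl | hv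
          · simp [schroederSteps]
          · exact h₂ v hv
      have hsum : (0, 0) + (s₁ ++ (2, 0) :: s₂).sum = (2 * (n : ℤ), 0) := by
        rw [List.sum_append, List.sum_cons, hsum₁, hsum₂]
        ext <;> simp; ring
      refine ⟨⟨hmem, hsum⟩, pathTrace_subset_region ⟨hmem, hsum⟩, ?_⟩
      rw [toPlane_mem_pathTrace_schroeder hmem]
      refine Or.inr ⟨s₁, s₂, rfl, ?_⟩
      rw [hsum₁]
      ext <;> simp
  · intro s hs
    obtain ⟨hs, hsum⟩ := mem_latticePaths_zero.1 hs
    exact ⟨fun v hv => fst_pos_of_mem_schroederSteps (hs v hv), by rw [hsum]⟩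

lemma mirror_mem_nonnegDyckPaths {h l k : ℤ} {s : List (ℤ × ℤ)}
    (hs : s ∈ nonnegDyckPaths h (l, k)) : mirror s ∈ nonnegDyckPaths (h + k) (l, -k) := by
  obtain ⟨h1, h2⟩ := hs
  obtain ⟨h1, h3⟩ := mem_latticePaths_zero.1 h1
  refine ⟨mem_latticePaths_zero.2 ⟨fun v hv => ?_, ?_⟩, ?_⟩
  · rw [← reflect_reflect v]
    exact reflect_mem_dyckSteps (h1 _ (mem_mirror.1 hv))
  · rw [sum_mirror, h3, reflect_apply]
  · have := h2.mirror
    rwa [h3] at this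

lemma ncard_nonnegDyckPaths_mirror (l k : ℤ) :
    (nonnegDyckPaths 0 (l, k)).ncard = (nonnegDyckPaths k (l, -k)).ncard := by
  have himage : mirror '' nonnegDyckPaths 0 (l, k) = nonnegDyckPaths k (l, -k) := by
    ext s
    constructor
    · rintro ⟨t, ht, rfl⟩
      simpa using mirror_mem_nonnegDyckPaths ht
    · intro hs
      refine ⟨mirror s, ?_, mirror_mirror s⟩
      simpa using mirror_mem_nonnegDyckPaths hs
  rw [← himage,
    Set.ncard_image_of_injective _ (Function.LeftInverse.injective mirror_mirror)]

/-- The second halves of the paths above the zigzag path start at height `k` and stay nonnegative;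
the first halves are their mirror images. -/
lemma zigzagDyckCount_eq_sq (n : ℕ) (k : ℤ) :
    zigzagDyckCount n k = (nonnegDyckPaths k ((n : ℤ), -k)).ncard ^ 2 := by
  rw [sq]
  nth_rw 1 [← ncard_nonnegDyckPaths_mirror]
  rw [← ncard_image2_append (l := n), zigzagDyckCount, countPathsThrough]
  · congr 1
    ext s
    simp only [Set.mem_ofPred_eq, Set.mem_image2]
    constructor
    · rintro ⟨hs, hreg, hmem⟩
      rw [pathTrace_subset_zigzag_region_iff hs] at hreg
      obtain ⟨hs, hsum⟩ := hs
      rw [toPlane_mem_pathTrace_schroeder fun v hv => dyckSteps_subset_schroederSteps (hs v hv)]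
        at hmem
      rcases hmem with ⟨s₁, s₂, rfl, h1⟩ | ⟨s₁, s₂, rfl, h1⟩
      · simp only [List.mem_append] at hs
        rw [Prod.mk_zero_zero, zero_add] at h1 hsum
        rw [staysNonneg_append, ← h1, zero_add] at hreg
        refine ⟨s₁, ⟨⟨fun v hv => hs v (Or.inl hv), ?_⟩, hreg.1⟩, s₂,
          ⟨⟨fun v hv => hs v (Or.inr hv), ?_⟩, hreg.2⟩, rfl⟩
        · rw [Prod.mk_zero_zero, zero_add, h1]
        · rw [List.sum_append, ← h1] at hsum
          rw [Prod.mk_zero_zero, zero_add, eq_sub_of_add_eq' hsum]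
          ext <;> simp; ring
      · have := hs (2, 0) (by simp)
        simp [dyckSteps] at this
    · rintro ⟨s₁, ⟨h₁, hn₁⟩, s₂, ⟨h₂, hn₂⟩, rfl⟩
      obtain ⟨h₁, hsum₁⟩ := mem_latticePaths_zero.1 h₁
      obtain ⟨h₂, hsum₂⟩ := mem_latticePaths_zero.1 h₂
      have hmem : ∀ v ∈ s₁ ++ s₂, v ∈ dyckSteps := by
        intro v hv
        rcases List.mem_append.1 hv with hv | hv
        · exact h₁ v hv
        · exact h₂ v hv
      have hsum : (0, 0) + (s₁ ++ s₂).sum = (2 * (n : ℤ), 0) := by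
        rw [List.sum_append, hsum₁, hsum₂]
        ext <;> simp; ring
      refine ⟨⟨hmem, hsum⟩, ?_, ?_⟩
      · rw [pathTrace_subset_zigzag_region_iff ⟨hmem, hsum⟩, staysNonneg_append, hsum₁, zero_add]
        exact ⟨hn₁, hn₂⟩
      · rw [toPlane_mem_pathTrace_schroeder
          fun v hv => dyckSteps_subset_schroederSteps (hmem v hv)]
        exact Or.inl ⟨s₁, s₂, rfl, by rw [Prod.mk_zero_zero, zero_add, hsum₁]⟩
  · rintro s ⟨hs, -⟩
    obtain ⟨hs, hsum⟩ := mem_latticePaths_zero.1 hs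
    exact ⟨fun v hv => fst_pos_of_mem_schroederSteps (dyckSteps_subset_schroederSteps (hs v hv)),
      by rw [hsum]⟩

/-! ### The numbers of half paths -/

/-- The change of coordinates that turns the steps `(1, 0)`, `(0, 1)`, `(1, 1)` into the steps
`(1, 1)`, `(1, -1)`, `(2, 0)`. -/
def rotate : ℤ × ℤ →+ ℤ × ℤ where
  toFun v := (v.1 + v.2, v.1 - v.2)
  map_zero' := rfl
  map_add' v w := by ext <;> simp <;> ring

lemma rotate_apply (v : ℤ × ℤ) : rotate v = (v.1 + v.2, v.1 - v.2) := rfl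

lemma rotate_injective : Function.Injective rotate := by
  intro v w h
  simp only [rotate_apply, Prod.mk.injEq] at h
  ext <;> omega

lemma ncard_schroederPaths (p q : ℕ) {l k : ℤ} (hl : (p : ℤ) + q = l) (hk : (p : ℤ) - q = k) :
    (latticePaths schroederSteps (0, 0) (l, k)).ncard = delannoy p q := by
  subst hl hk
  have := ncard_latticePaths_image rotate rotate_injective {(1, 0), (0, 1), (1, 1)} (p, q)
  simpa [Set.image_insert_eq, rotate_apply, schroederSteps, delannoy] using this

lemma ncard_dyckPaths (p q : ℕ) {l k : ℤ} (hl : (p : ℤ) + q = l) (hk : (p : ℤ) - q = k) :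
    (latticePaths dyckSteps (0, 0) (l, k)).ncard = (p + q).choose p := by
  subst hl hk
  have := ncard_latticePaths_image rotate rotate_injective {(1, 0), (0, 1)} (p, q)
  rw [Set.ncard, Set.ncard, encard_binomialPaths] at this
  simpa [Set.image_insert_eq, rotate_apply, dyckSteps, Set.ncard] using this

lemma ncard_nonnegDyckPaths {p q : ℕ} (h : q ≤ p + 1) {l k : ℤ} (hl : (p : ℤ) + q = l)
    (hk : (p : ℤ) - q = k) :
    ((nonnegDyckPaths k (l, -k)).ncard : ℚ) = ballotNumber p q := by
  subst hl hk
  obtain ⟨c, hc, hcb⟩ := exists_encard_nonnegPaths_eq_ballotNumber _ p q rfl h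
  rw [neg_sub, Set.ncard, hc, ENat.toNat_natCast, hcb]

/-- The endpoint of a Schröder path has coordinates `p + q` and `p - q` with natural numbers `p` and
`q`: the parities agree, and the slopes are at most `1` in absolute value. -/
lemma exists_nat_of_mem_latticePaths {S : Set (ℤ × ℤ)} (hS : S ⊆ schroederSteps) {l k : ℤ}
    {s : List (ℤ × ℤ)} (hs : s ∈ latticePaths S (0, 0) (l, k)) :
    ∃ p q : ℕ, (p : ℤ) + q = l ∧ (p : ℤ) - q = k := by
  obtain ⟨hs, hsum⟩ := mem_latticePaths_zero.1 hs
  have h1 := abs_snd_sum_le_fst_sum fun v hv => hS (hs v hv)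
  obtain ⟨r, h2⟩ := even_fst_add_snd_sum fun v hv => hS (hs v hv)
  rw [hsum] at h1 h2
  rw [abs_le] at h1
  dsimp only at h1 h2
  exact ⟨r.toNat, (l - r).toNat, by omega, by omega⟩

/-- A function on the integers that is supported on the differences `p - q` with `p + q = l`
satisfies the log-concavity inequality everywhere if it does so on the antidiagonal. -/
lemma logConcave_of_antidiagonal (f : ℤ → ℕ) (l : ℤ)
    (hsupp : ∀ k, f k ≠ 0 → ∃ p q : ℕ, (p : ℤ) + q = l ∧ (p : ℤ) - q = k)
    (h : ∀ p q : ℕ, (p : ℤ) + q + 2 = l → f ((p : ℤ) - q - 2) ≠ 0 →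
      f ((p : ℤ) - q + 2) * f ((p : ℤ) - q - 2) ≤ f ((p : ℤ) - q) ^ 2) (k : ℤ) :
    f (k + 2) * f (k - 2) ≤ f k ^ 2 := by
  by_cases h1 : f (k + 2) = 0
  · simp [h1]
  by_cases h2 : f (k - 2) = 0
  · simp [h2]
  obtain ⟨p, q, hl, hk⟩ := hsupp _ h1
  obtain ⟨p', q', hl', hk'⟩ := hsupp _ h2
  obtain rfl : k = (p' : ℤ) - q := by omega
  exact h p' q (by omega) h2

lemma ncard_schroederPaths_logConcave (l k : ℤ) :
    (latticePaths schroederSteps (0, 0) (l, k + 2)).ncard *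
        (latticePaths schroederSteps (0, 0) (l, k - 2)).ncard ≤
      (latticePaths schroederSteps (0, 0) (l, k)).ncard ^ 2 := by
  refine logConcave_of_antidiagonal
    (fun k => (latticePaths schroederSteps (0, 0) (l, k)).ncard) l (fun k hk => ?_) ?_ k
  · obtain ⟨s, hs⟩ := Set.nonempty_of_ncard_ne_zero hk
    exact exists_nat_of_mem_latticePaths subset_rfl hs
  · rintro p q rfl -
    have h1 := delannoy_logConcave p q
    rw [ncard_schroederPaths (p + 2) q, ncard_schroederPaths p (q + 2),
      ncard_schroederPaths (p + 1) (q + 1)]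
    · exact h1
    all_goals omega

lemma ncard_dyckPaths_logConcave (l k : ℤ) :
    (latticePaths dyckSteps (0, 0) (l, k + 2)).ncard *
        (latticePaths dyckSteps (0, 0) (l, k - 2)).ncard ≤
      (latticePaths dyckSteps (0, 0) (l, k)).ncard ^ 2 := by
  refine logConcave_of_antidiagonal
    (fun k => (latticePaths dyckSteps (0, 0) (l, k)).ncard) l (fun k hk => ?_) ?_ k
  · obtain ⟨s, hs⟩ := Set.nonempty_of_ncard_ne_zero hk
    exact exists_nat_of_mem_latticePaths dyckSteps_subset_schroederSteps hs
  · rintro p q rfl -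
    have h1 := choose_logConcave (p + q + 2) p
    rw [ncard_dyckPaths (p + 2) q, ncard_dyckPaths p (q + 2), ncard_dyckPaths (p + 1) (q + 1)]
    · convert h1 using 3 <;> ring
    all_goals omega

lemma ncard_nonnegDyckPaths_logConcave (l k : ℤ) :
    (nonnegDyckPaths (k + 2) (l, -(k + 2))).ncard *
        (nonnegDyckPaths (k - 2) (l, -(k - 2))).ncard ≤
      (nonnegDyckPaths k (l, -k)).ncard ^ 2 := by
  refine logConcave_of_antidiagonal
    (fun k => (nonnegDyckPaths k (l, -k)).ncard) l (fun k hk => ?_) ?_ k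
  · obtain ⟨s, hs, -⟩ := Set.nonempty_of_ncard_ne_zero hk
    obtain ⟨p, q, hl, hk⟩ := exists_nat_of_mem_latticePaths dyckSteps_subset_schroederSteps hs
    exact ⟨q, p, by omega, by omega⟩
  · rintro p q rfl h
    obtain ⟨s, -, hs⟩ := Set.nonempty_of_ncard_ne_zero h
    -- a nonnegative path starts at height `p - q - 2`, so `q + 2 ≤ p`, which is the range where the
    -- ballot numbers are log-concave
    have hpq := hs.start_nonneg
    have h1 := ballotNumber_logConcave (p := p) (q := q) (by omega)
    rw [← Nat.cast_le (α := ℚ), Nat.cast_mul, Nat.cast_pow]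
    rw [ncard_nonnegDyckPaths (p := p + 2) (q := q), ncard_nonnegDyckPaths (p := p) (q := q + 2),
      ncard_nonnegDyckPaths (p := p + 1) (q := q + 1)]
    · exact h1
    all_goals omega

lemma mul_sq_le_sq_sq {a b c : ℕ} (h : a * b ≤ c ^ 2) : a ^ 2 * b ^ 2 ≤ (c ^ 2) ^ 2 := by
  rw [← mul_pow]
  exact Nat.pow_le_pow_left h 2

theorem mainTheorem7 (n : ℕ) :
    ((∀ k : ℤ, schroederCount n (k + 2) * schroederCount n (k - 2) ≤ schroederCount n k ^ 2) ∧
      (∀ k : ℕ, k ≤ n → schroederCount n (2 * (k : ℤ) - n) = delannoy k (n - k) ^ 2) ∧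
      (∀ k : ℕ, 1 ≤ k → k + 1 ≤ n →
        delannoy (k + 1) (n - (k + 1)) * delannoy (k - 1) (n - (k - 1)) ≤
          delannoy k (n - k) ^ 2)) ∧
    ((∀ k : ℤ, dyckCount n (k + 2) * dyckCount n (k - 2) ≤ dyckCount n k ^ 2) ∧
      (∀ k : ℕ, k ≤ n → dyckCount n (2 * (k : ℤ) - n) = n.choose k ^ 2) ∧
      (∀ k : ℕ, 1 ≤ k → k + 1 ≤ n →
        n.choose (k + 1) * n.choose (k - 1) ≤ n.choose k ^ 2)) ∧
    ((∀ k : ℤ, zigzagDyckCount n (k + 2) * zigzagDyckCount n (k - 2) ≤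
        zigzagDyckCount n k ^ 2) ∧
      (∀ k : ℕ, n ≤ 2 * k → k ≤ n →
        (zigzagDyckCount n (2 * (k : ℤ) - n) : ℚ) = ballotNumber k (n - k) ^ 2) ∧
      (∀ k : ℕ, n + 2 ≤ 2 * k → k + 1 ≤ n →
        ballotNumber (k + 1) (n - (k + 1)) * ballotNumber (k - 1) (n - (k - 1)) ≤
          ballotNumber k (n - k) ^ 2)) := by
  refine ⟨⟨fun k => ?_, fun k hk => ?_, fun k hk hkn => ?_⟩,
    ⟨fun k => ?_, fun k hk => ?_, fun k hk hkn => ?_⟩,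
    ⟨fun k => ?_, fun k hkn hk => ?_, fun k hk hkn => ?_⟩⟩
  · by_cases h : Even ((n : ℤ) + k)
    · rw [schroederCount_of_even h, schroederCount_of_even (by grind),
        schroederCount_of_even (by grind)]
      exact mul_sq_le_sq_sq (ncard_schroederPaths_logConcave _ _)
    · rw [schroederCount_of_not_even h, schroederCount_of_not_even (by grind),
        schroederCount_of_not_even (by grind)]
      exact mul_sq_le_sq_sq (ncard_schroederPaths_logConcave _ _)
  · obtain ⟨q, rfl⟩ := Nat.exists_eq_add_of_le hk
    rw [schroederCount_of_even ⟨k, by push_cast; ring⟩, Nat.add_sub_cancel_left,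
      ncard_schroederPaths k q] <;> omega
  · obtain ⟨p, rfl⟩ := Nat.exists_eq_add_of_le' hk
    obtain ⟨q, rfl⟩ := Nat.exists_eq_add_of_le hkn
    convert delannoy_logConcave p q using 3 <;> omega
  · rw [dyckCount_eq_sq, dyckCount_eq_sq, dyckCount_eq_sq]
    exact mul_sq_le_sq_sq (ncard_dyckPaths_logConcave _ _)
  · obtain ⟨q, rfl⟩ := Nat.exists_eq_add_of_le hk
    rw [dyckCount_eq_sq, ncard_dyckPaths k q] <;> omega
  · obtain ⟨p, rfl⟩ := Nat.exists_eq_add_of_le' hk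
    exact choose_logConcave n p
  · rw [zigzagDyckCount_eq_sq, zigzagDyckCount_eq_sq, zigzagDyckCount_eq_sq]
    exact mul_sq_le_sq_sq (ncard_nonnegDyckPaths_logConcave _ _)
  · obtain ⟨q, rfl⟩ := Nat.exists_eq_add_of_le hk
    rw [zigzagDyckCount_eq_sq, Nat.add_sub_cancel_left,
      Nat.cast_pow, ncard_nonnegDyckPaths (p := k) (q := q)] <;> omega
  · obtain ⟨p, rfl⟩ := Nat.exists_eq_add_of_le' (show 1 ≤ k by omega)
    obtain ⟨q, rfl⟩ := Nat.exists_eq_add_of_le hkn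
    convert ballotNumber_logConcave (p := p) (q := q) (by omega) using 3 <;> omega
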